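/- Let $\mathbb{N}=\{1,2,3,\dots\}$ and let $\Phi$ be the set of non-decreasing functions $\alpha:\mathbb{N}\to(0,\infty)$ such that $\sum_{i=1}^\infty 1/\alpha(i)$ converges and is at most $1$. Let $X$ be a set of $n$ points with a metric $d$, let $x_1,\dots,x_n$ be a ranking (enumeration) of $X$, and let $f$ be a map from $X$ to a metric space $(Y,d_Y)$. The map $f$ is non-contractive if $d(u,v)\le d_Y(f(u),f(v))$ for all $u,v\in X$. It has priority distortion $\beta:\mathbb{N}\to\mathbb{R}$ if $d_Y(f(x_j),f(x_i))\le\beta(j)\,d(x_j,x_i)$ for all $1\le j<i\le n$, and priority distortion less than $\alpha$ if it has priority distortion $\beta$ for some $\beta$ with $\beta(k)<\alpha(k)$ for every $k$. A tree metric is the shortest-path metric on the vertex set of a finite tree with positive edge weights. An embedding of $X$ into a dominating tree metric is a non-contractive map from $X$ to the vertices of such a tree; the tree may have vertices that are not images of points of $X$ (Steiner nodes). **Lower bounds.** Let $\alpha:\mathbb{N}\to\mathbb{R}$ be non-decreasing with $\alpha\notin\Phi$; for positive $\alpha$ this means that $\sum_i 1/\alpha(i)$ diverges or is greater than $1$.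 Then there are an integer $n\ge3$ and a ranking $x_1,\dots,x_n$ of the vertices of the cycle $C_n$ with unit edge weights, with shortest-path metric $d$, such that 1. no spanning tree of $C_n$ (with its own shortest-path metric and the identity map on the vertices) has priority distortion less than $\alpha$; 2. there is no embedding of $(V(C_n),d)$ into a dominating tree metric with priority distortion less than $\alpha/8$. **Tightness up to constants.** Conversely, if $\alpha\in\Phi$, then every finite metric space, with every ranking of its points, has an embedding into a dominating tree metric with priority distortion $2\alpha$. -/

import Mathlib

/-- The family `Φ` of positive non-decreasing functions `α : {1, 2, 3, …} → ℝ` whose series of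
reciprocals converges to a sum which is at most `1`. -/
def Phi : Set (ℕ+ → ℝ) :=
  {α | (∀ i, 0 < α i) ∧ Monotone α ∧
    Summable (fun i : ℕ+ => 1 / α i) ∧ ∑' i : ℕ+, 1 / α i ≤ 1}

/-- A map between sets with distance functions is non-contractive if it does not decrease any
distance. -/
def NonContractive {X Y : Type*} (dX : X → X → ℝ) (dY : Y → Y → ℝ) (f : X → Y) : Prop :=
  ∀ u v, dX u v ≤ dY (f u) (f v)

/-- The map `f` has priority distortion `β` with respect to the ranking `x` of the points of `X`.
The ranking lists the points as `x 0, …, x (n - 1)`, so that `x j` is the point of rank `j + 1`,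
to which the value `β (j + 1)` belongs. -/
def HasPriorityDistortion {X Y : Type*} {n : ℕ} (dX : X → X → ℝ) (dY : Y → Y → ℝ)
    (x : Fin n ≃ X) (f : X → Y) (β : ℕ+ → ℝ) : Prop :=
  ∀ j i : Fin n, j < i →
    dY (f (x j)) (f (x i)) ≤ β (Nat.succPNat (j : ℕ)) * dX (x j) (x i)

/-- The map `f` has priority distortion less than `α`: it has priority distortion `β` for some
function `β` that is pointwise smaller than `α`. -/
def PriorityDistortionLT {X Y : Type*} {n : ℕ} (dX : X → X → ℝ) (dY : Y → Y → ℝ)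
    (x : Fin n ≃ X) (f : X → Y) (α : ℕ+ → ℝ) : Prop :=
  ∃ β : ℕ+ → ℝ, (∀ k, β k < α k) ∧ HasPriorityDistortion dX dY x f β

/-- A tree on the vertex set `W` with positive edge weights. -/
structure WeightedTree (W : Type*) where
  graph : SimpleGraph W
  isTree : graph.IsTree
  weight : Sym2 W → ℝ
  weight_pos : ∀ e ∈ graph.edgeSet, 0 < weight e

/-- The total weight of the edges of a walk in a weighted tree. -/
def WeightedTree.walkWeight {W : Type*} (T : WeightedTree W) {u v : W}
    (p : T.graph.Walk u v) : ℝ :=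
  (p.edges.map T.weight).sum

/-- The tree metric: the total weight of the unique path between two vertices. -/
noncomputable def WeightedTree.dist {W : Type*} (T : WeightedTree W) (u v : W) : ℝ :=
  T.walkWeight (T.isTree.existsUnique_path u v).choose

theorem WeightedTree.dist_eq_walkWeight {W : Type*} (T : WeightedTree W) {u v : W}
    (p : T.graph.Walk u v) (hp : p.IsPath) : T.dist u v = T.walkWeight p := by
  have h := (T.isTree.existsUnique_path u v).choose_spec
  rw [h.2 p hp]
  rfl

/-- The shortest path metric of a connected graph with unit edge weights. -/
noncomputable def graphMetric {V : Type*} (G : SimpleGraph V) (u v : V) : ℝ :=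
  (G.dist u v : ℝ)

/-!
Upper bound. Let `u, w` realize the diameter `Δ` of a finite set `S`. A radius `r` in `[0, Δ)` is bad
for the point `x` if it differs from the distance between `u` and `x` by less than `Δ / (2 * α)`, with
`α` taken at the rank of `x`; the bad radii of `x` lie in an interval of length `Δ / α`. The reciprocals
of `α` at the ranks of the points sum to less than `1`, because the series has further positive
terms, so some radius is good for all points (`exists_cut_radius`). The ball of this radius cuts `S`
into two parts such that each point has distance at least `Δ / (2 * α)` from the part not containing
it. Giving all pairs that are cut the distance `Δ` and recursing into both parts yields an ultrametric
with priority distortion `2 * α`, which is realized by the leaves of a rooted tree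
(`exists_rooted_tree`). Since edge weights must be positive and a part may have the same diameter as
`S`, the heights in the tree are chosen slightly above half the diameters; the strict inequality for
the sum of the reciprocals pays for this.

Lower bounds. Every map of the cycle considered here stretches some edge `a b` to length at least
`D`: the missing edge of a spanning tree has `D = n - 1`
(`exists_stretched_edge_of_le_cycleGraph`), and for a dominating tree `D = (n - 1) / 8` is possible.
For the latter, take three equally spaced vertices of the cycle. If all edges were short, the images
of all three arcs between these vertices would pass close to the median of their images
(`WeightedTree.exists_median`). This would give one point on each arc, with all three close to each
other in the tree and thus, by non-contractiveness, in the cycle; but going around the cycle through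
these points, one of the three steps has length at least about `n / 3` in both directions
(`exists_stretched_edge_of_nonContractive`).

By the triangle inequality, a point at distance at most `ℓ` from both `a` and `b` has distortion at
least `D / (2 * ℓ)` with one of them (`not_priorityDistortionLT_of_stretched_edge`). So if the point
`x j` is surrounded by an arc of radius about `n / (2 * α j)`, it rules out every tree that stretches
an edge of that arc. The arcs have total length about `n * ∑ 1 / α j`, which exceeds `n` for suitable
`n` if some partial sum is above `1`, so they can be laid out to cover the whole cycle
(`exists_covering_ranking`).
-/

/-! ### Tree metrics -/

namespace WeightedTree

variable {W : Type*} (T : WeightedTree W)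

theorem walkWeight_append {u v w : W} (p : T.graph.Walk u v) (q : T.graph.Walk v w) :
    T.walkWeight (p.append q) = T.walkWeight p + T.walkWeight q := by
  simp [walkWeight]

theorem walkWeight_reverse {u v : W} (p : T.graph.Walk u v) :
    T.walkWeight p.reverse = T.walkWeight p := by
  simp [walkWeight]

theorem dist_le_walkWeight {u v : W} (p : T.graph.Walk u v) : T.dist u v ≤ T.walkWeight p := by
  classical
  rw [T.dist_eq_walkWeight p.bypass p.bypass_isPath]
  refine (p.edges_bypass_sublist_edges.map T.weight).sum_le_sum fun x hx => ?_
  obtain ⟨e, he, rfl⟩ := List.mem_map.1 hx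
  exact (T.weight_pos e (p.edges_subset_edgeSet he)).le

theorem exists_isPath (u v : W) : ∃ p : T.graph.Walk u v, p.IsPath :=
  (T.isTree.existsUnique_path u v).exists

theorem dist_comm (u v : W) : T.dist u v = T.dist v u := by
  obtain ⟨p, hp⟩ := T.exists_isPath u v
  rw [T.dist_eq_walkWeight p hp, T.dist_eq_walkWeight p.reverse hp.reverse, walkWeight_reverse]

theorem dist_self (u : W) : T.dist u u = 0 := by
  rw [T.dist_eq_walkWeight .nil .nil]
  simp [walkWeight]

theorem dist_triangle (u v w : W) : T.dist u w ≤ T.dist u v + T.dist v w := by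
  obtain ⟨p, hp⟩ := T.exists_isPath u v
  obtain ⟨q, hq⟩ := T.exists_isPath v w
  rw [T.dist_eq_walkWeight p hp, T.dist_eq_walkWeight q hq, ← walkWeight_append]
  exact T.dist_le_walkWeight _

theorem dist_add_dist_of_mem_support {u v t : W} {p : T.graph.Walk u v} (hp : p.IsPath)
    (ht : t ∈ p.support) : T.dist u t + T.dist t v = T.dist u v := by
  classical
  rw [T.dist_eq_walkWeight p hp, T.dist_eq_walkWeight _ (hp.takeUntil ht),
    T.dist_eq_walkWeight _ (hp.dropUntil ht), ← walkWeight_append, p.take_spec]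

/-- In a tree the path between two vertices is contained in every walk between them. -/
theorem support_subset_of_isPath {u v : W} {p : T.graph.Walk u v} (hp : p.IsPath)
    (q : T.graph.Walk u v) : p.support ⊆ q.support := by
  classical
  rw [(T.isTree.existsUnique_path u v).unique hp q.bypass_isPath]
  exact q.support_bypass_subset_support

/-- Three vertices of a tree have a median: a vertex lying on all walks between any two of
them. -/
theorem exists_median (a b c : W) : ∃ t, (∀ p : T.graph.Walk a b, t ∈ p.support) ∧
    (∀ p : T.graph.Walk b c, t ∈ p.support) ∧ ∀ p : T.graph.Walk c a, t ∈ p.support := by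
  classical
  obtain ⟨p, hp⟩ := T.exists_isPath a b
  obtain ⟨q, hq⟩ := T.exists_isPath c b
  -- the median is the first vertex of the path from `c` to `b` on the path from `a` to `b`
  have hex : ∃ n, n ≤ q.length ∧ q.getVert n ∈ p.support := ⟨q.length, le_rfl, by simp⟩
  obtain ⟨hn, ht⟩ := Nat.find_spec hex
  have hmin : ∀ m < Nat.find hex, q.getVert m ∉ p.support := fun m hm h =>
    Nat.find_min hex hm ⟨hm.le.trans hn, h⟩
  set n := Nat.find hex
  refine ⟨q.getVert n, fun r => T.support_subset_of_isPath hp r ht, fun r => ?_, fun r => ?_⟩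
  · have := T.support_subset_of_isPath hq r.reverse (q.getVert_mem_support n)
    simpa using this
  · have hpath : ((q.take n).append (p.takeUntil _ ht).reverse).IsPath := by
      rw [SimpleGraph.Walk.isPath_def, SimpleGraph.Walk.support_append, List.nodup_append']
      have h1 := (hp.takeUntil ht).reverse
      refine ⟨(hq.take n).support_nodup, h1.support_nodup.tail, ?_⟩
      intro x hx hx'
      obtain ⟨m, rfl, hm⟩ := SimpleGraph.Walk.mem_support_iff_exists_getVert.1 hx
      have hx'' : (q.take n).getVert m ∈ p.support := by
        have := List.mem_of_mem_tail hx'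
        rw [SimpleGraph.Walk.support_reverse, List.mem_reverse] at this
        exact p.support_takeUntil_subset_support ht this
      rw [SimpleGraph.Walk.take_getVert] at hx'' hx'
      rcases lt_or_ge m n with h | h
      · rw [min_eq_right h.le] at hx''
        exact hmin m h hx''
      · rw [min_eq_left h] at hx'
        have h2 := h1.support_nodup
        rw [← SimpleGraph.Walk.cons_tail_support] at h2
        exact (List.nodup_cons.1 h2).1 hx'
    refine T.support_subset_of_isPath hpath r ?_
    rw [SimpleGraph.Walk.mem_support_append_iff]
    exact Or.inl (SimpleGraph.Walk.end_mem_support _)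

/-! ### Joining two trees by an edge -/

/-- The tree with one vertex. -/
def single : WeightedTree Unit where
  graph := ⊥
  isTree := .of_subsingleton
  weight := fun _ => 1
  weight_pos := fun _ _ => one_pos

/-- Edge weights on a disjoint union of two vertex sets: the given weights `w₁` and `w₂` inside the
two parts, and `c` on all pairs across. -/
def joinWeight {W₁ W₂ : Type*} (w₁ : Sym2 W₁ → ℝ) (w₂ : Sym2 W₂ → ℝ) (c : ℝ) :
    Sym2 (W₁ ⊕ W₂) → ℝ :=
  Sym2.lift ⟨fun
    | .inl x, .inl y => w₁ s(x, y)
    | .inr x, .inr y => w₂ s(x, y)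
    | _, _ => c, by
      rintro (x | x) (y | y) <;> simp [Sym2.eq_swap]⟩

/-- The disjoint union of two trees, made into a tree by an edge of weight `c` between a vertex `a`
of the one and a vertex `b` of the other. -/
def join {W₁ W₂ : Type*} [Finite W₁] [Finite W₂] (T₁ : WeightedTree W₁) (T₂ : WeightedTree W₂)
    (a : W₁) (b : W₂) (c : ℝ) (hc : 0 < c) : WeightedTree (W₁ ⊕ W₂) where
  graph := (T₁.graph.sum T₂.graph) ⊔ SimpleGraph.edge (.inl a) (.inr b)
  isTree := by
    rw [SimpleGraph.isTree_iff_connected_and_card]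
    refine ⟨T₁.isTree.connected.sum_sup_edge T₂.isTree.connected, ?_⟩
    have h₁ := (SimpleGraph.isTree_iff_connected_and_card.1 T₁.isTree).2
    have h₂ := (SimpleGraph.isTree_iff_connected_and_card.1 T₂.isTree).2
    have h := Nat.card_congr (SimpleGraph.edgeSetSumEquiv (G := T₁.graph) (H := T₂.graph))
    rw [Nat.card_sum] at h
    have hne : (Sum.inl a : W₁ ⊕ W₂) ≠ Sum.inr b := by simp
    rw [SimpleGraph.edgeSet_sup, SimpleGraph.edgeSet_edge_of_ne hne, Nat.card_coe_set_eq,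
      Set.union_singleton, Set.ncard_insert_of_notMem (by simp), ← Nat.card_coe_set_eq, h,
      Nat.card_sum]
    omega
  weight := joinWeight T₁.weight T₂.weight c
  weight_pos := by
    intro e
    induction e with
    | _ x y =>
    intro he
    rcases x with x | x <;> rcases y with y | y
    · exact T₁.weight_pos s(x, y) (by simpa [SimpleGraph.edge_adj] using he)
    · exact hc
    · exact hc
    · exact T₂.weight_pos s(x, y) (by simpa [SimpleGraph.edge_adj] using he)

section join

variable {W₁ W₂ : Type*} [Finite W₁] [Finite W₂] (T₁ : WeightedTree W₁) (T₂ : WeightedTree W₂)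
    (a : W₁) (b : W₂) (c : ℝ) (hc : 0 < c)

/-- The inclusion of the first of two joined trees. -/
def joinInl : T₁.graph →g (join T₁ T₂ a b c hc).graph :=
  ⟨Sum.inl, fun h => Or.inl (SimpleGraph.sum_adj_inl.2 h)⟩

/-- The inclusion of the second of two joined trees. -/
def joinInr : T₂.graph →g (join T₁ T₂ a b c hc).graph :=
  ⟨Sum.inr, fun h => Or.inl (SimpleGraph.sum_adj_inr.2 h)⟩

theorem walkWeight_map_joinInl {u v : W₁} (p : T₁.graph.Walk u v) :
    (join T₁ T₂ a b c hc).walkWeight (p.map (joinInl T₁ T₂ a b c hc)) = T₁.walkWeight p := by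
  simp only [walkWeight, SimpleGraph.Walk.edges_map, List.map_map]
  congr 2
  ext e
  induction e with
  | _ x y => rfl

theorem walkWeight_map_joinInr {u v : W₂} (p : T₂.graph.Walk u v) :
    (join T₁ T₂ a b c hc).walkWeight (p.map (joinInr T₁ T₂ a b c hc)) = T₂.walkWeight p := by
  simp only [walkWeight, SimpleGraph.Walk.edges_map, List.map_map]
  congr 2
  ext e
  induction e with
  | _ x y => rfl

theorem join_dist_inl (u v : W₁) :
    (join T₁ T₂ a b c hc).dist (.inl u) (.inl v) = T₁.dist u v := by
  obtain ⟨p, hp⟩ := T₁.exists_isPath u v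
  rw [T₁.dist_eq_walkWeight p hp, ← walkWeight_map_joinInl T₁ T₂ a b c hc]
  exact dist_eq_walkWeight _ _ (hp.map Sum.inl_injective)

theorem join_dist_inr (u v : W₂) :
    (join T₁ T₂ a b c hc).dist (.inr u) (.inr v) = T₂.dist u v := by
  obtain ⟨p, hp⟩ := T₂.exists_isPath u v
  rw [T₂.dist_eq_walkWeight p hp, ← walkWeight_map_joinInr T₁ T₂ a b c hc]
  exact dist_eq_walkWeight _ _ (hp.map Sum.inr_injective)

theorem join_dist_inl_inr (u : W₁) (v : W₂) :
    (join T₁ T₂ a b c hc).dist (.inl u) (.inr v) = T₁.dist u a + c + T₂.dist b v := by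
  obtain ⟨p, hp⟩ := T₁.exists_isPath u a
  obtain ⟨q, hq⟩ := T₂.exists_isPath b v
  let φ := joinInl T₁ T₂ a b c hc
  let ψ := joinInr T₁ T₂ a b c hc
  have hadj : (join T₁ T₂ a b c hc).graph.Adj (φ a) (ψ b) :=
    Or.inr (show (SimpleGraph.edge (Sum.inl a) (Sum.inr b)).Adj (.inl a) (.inr b) by
      simp [SimpleGraph.edge_adj])
  have hφ : (p.map φ).IsPath := hp.map Sum.inl_injective
  have hψ : (q.map ψ).IsPath := hq.map Sum.inr_injective
  have hpath : ((p.map φ).append (.cons hadj (q.map ψ))).IsPath := by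
    rw [SimpleGraph.Walk.isPath_def, SimpleGraph.Walk.support_append, List.nodup_append']
    refine ⟨hφ.support_nodup, by simpa using hψ.support_nodup, ?_⟩
    intro x hx hx'
    simp only [SimpleGraph.Walk.support_map, SimpleGraph.Walk.support_cons, List.tail_cons,
      List.mem_map] at hx hx'
    obtain ⟨y, -, rfl⟩ := hx
    obtain ⟨z, -, hz⟩ := hx'
    exact Sum.inr_ne_inl hz
  have hcons : (join T₁ T₂ a b c hc).walkWeight (.cons hadj (q.map ψ)) =
      c + (join T₁ T₂ a b c hc).walkWeight (q.map ψ) := by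
    simp only [walkWeight, SimpleGraph.Walk.edges_cons, List.map_cons, List.sum_cons]
    rfl
  refine (dist_eq_walkWeight _ _ hpath).trans ?_
  rw [walkWeight_append, hcons, walkWeight_map_joinInl, walkWeight_map_joinInr,
    T₁.dist_eq_walkWeight p hp, T₂.dist_eq_walkWeight q hq, add_assoc]

end join

end WeightedTree

/-! ### Trees of small priority distortion -/

/-- The open intervals of radius `ρ x` around the values `dist u x` have total length less than
`Δ`, so they leave a point of `[0, Δ)` uncovered. -/
theorem exists_cut_radius {X : Type*} [MetricSpace X] (S : Finset X) (u : X) (ρ : X → ℝ)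
    (hρ : ∀ x ∈ S, 0 ≤ ρ x) (Δ : ℝ) (h : ∑ x ∈ S, 2 * ρ x < Δ) :
    ∃ r, 0 ≤ r ∧ r < Δ ∧ ∀ x ∈ S, ρ x ≤ |dist u x - r| := by
  by_contra! hcon
  have hsub : Set.Ico 0 Δ ⊆ ⋃ x ∈ S, Set.Ioo (dist u x - ρ x) (dist u x + ρ x) := by
    intro r hr
    obtain ⟨x, hx, hxr⟩ := hcon r hr.1 hr.2
    rw [abs_lt] at hxr
    simp only [Set.mem_iUnion, Set.mem_Ioo]
    exact ⟨x, hx, by linarith, by linarith⟩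
  have hle := (MeasureTheory.measure_mono (μ := MeasureTheory.volume) hsub).trans
    (MeasureTheory.measure_biUnion_finset_le _ _)
  have hsum : ∑ x ∈ S, MeasureTheory.volume (Set.Ioo (dist u x - ρ x) (dist u x + ρ x)) =
      ENNReal.ofReal (∑ x ∈ S, 2 * ρ x) := by
    rw [ENNReal.ofReal_sum_of_nonneg fun x hx => mul_nonneg zero_le_two (hρ x hx)]
    refine Finset.sum_congr rfl fun x _ => ?_
    rw [Real.volume_Ioo]
    congr 1
    ring
  rw [hsum, Real.volume_Ico, sub_zero, ENNReal.ofReal_le_ofReal_iff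
    (Finset.sum_nonneg fun x hx => mul_nonneg zero_le_two (hρ x hx))] at hle
  exact absurd h hle.not_gt

/-- A finite set can be cut along a ball centred at an end of a diameter so that every point `x`
is far, in proportion to `1 / κ x`, from the part not containing it. -/
theorem exists_cut {X : Type*} [MetricSpace X] [DecidableEq X] (κ : X → ℝ) (hκ : ∀ x, 0 < κ x)
    {lam : ℝ} (hlam : 1 < lam) (S : Finset X) (hsum : ∑ x ∈ S, lam / κ x < 1)
    (hS : S.Nontrivial) : ∃ A B : Finset X, ∃ Δ > 0, A ∪ B = S ∧ A ⊂ S ∧ B ⊂ S ∧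
      A.Nonempty ∧ B.Nonempty ∧ (∃ u ∈ S, ∃ v ∈ S, dist u v = Δ) ∧
      (∀ u ∈ S, ∀ v ∈ S, dist u v ≤ Δ) ∧
      ∀ u ∈ A, ∀ v ∈ B, lam * Δ ≤ 2 * κ u * dist u v ∧ lam * Δ ≤ 2 * κ v * dist u v := by
  obtain ⟨⟨u, w⟩, huw, hmax⟩ := (S ×ˢ S).exists_max_image (fun p => dist p.1 p.2)
    (hS.nonempty.product hS.nonempty)
  obtain ⟨hu, hw⟩ := Finset.mem_product.1 huw
  have hdiam : ∀ x ∈ S, ∀ y ∈ S, dist x y ≤ dist u w := fun x hx y hy =>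
    hmax (x, y) (Finset.mk_mem_product hx hy)
  obtain ⟨x, hx, y, hy, hxy⟩ := hS
  have hΔ : 0 < dist u w := (dist_pos.2 hxy).trans_le (hdiam x hx y hy)
  obtain ⟨r, hr0, hr1, hr⟩ := exists_cut_radius S u (fun x => lam * dist u w / (2 * κ x))
    (fun x _ => by have := hκ x; positivity) (dist u w) (by
      calc ∑ x ∈ S, 2 * (lam * dist u w / (2 * κ x)) = (∑ x ∈ S, lam / κ x) * dist u w := by
            rw [Finset.sum_mul]
            refine Finset.sum_congr rfl fun x _ => ?_
            have := (hκ x).ne'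
            field_simp
        _ < 1 * dist u w := mul_lt_mul_of_pos_right hsum hΔ
        _ = dist u w := one_mul _)
  have huA : u ∈ S.filter fun x => dist u x ≤ r := by simp [hu, hr0]
  have hwB : w ∈ S.filter fun x => ¬ dist u x ≤ r := by simp [hw, hr1]
  refine ⟨S.filter fun x => dist u x ≤ r, S.filter fun x => ¬ dist u x ≤ r, dist u w, hΔ,
    Finset.filter_union_filter_not_eq _ _, ?_, ?_, ⟨u, huA⟩, ⟨w, hwB⟩,
    ⟨u, hu, w, hw, rfl⟩, hdiam, ?_⟩
  · exact Finset.filter_ssubset.2 ⟨w, hw, (Finset.mem_filter.1 hwB).2⟩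
  · exact Finset.filter_ssubset.2 ⟨u, hu, by simpa using hr0⟩
  · intro x hx y hy
    obtain ⟨hxS, hxr⟩ := Finset.mem_filter.1 hx
    obtain ⟨hyS, hyr⟩ := Finset.mem_filter.1 hy
    push Not at hyr
    have h1 := hr x hxS
    have h2 := hr y hyS
    have h3 : dist u y ≤ dist u x + dist x y := dist_triangle u x y
    rw [abs_of_nonpos (by linarith)] at h1
    rw [abs_of_nonneg (by linarith)] at h2
    have hx0 := hκ x
    have hy0 := hκ y
    constructor
    · have : lam * dist u w / (2 * κ x) ≤ dist x y := by linarith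
      rwa [div_le_iff₀' (by positivity)] at this
    · have : lam * dist u w / (2 * κ y) ≤ dist x y := by linarith
      rwa [div_le_iff₀' (by positivity)] at this

/-- Recursive cutting turns a finite set `S` into a rooted tree whose leaves represent the points
of `S` and all have the same height `θ`, where `2 * θ` is any number above the diameter. The factor
`lam` leaves room for heights above half the diameter of the sets that occur in the recursion. -/
theorem exists_rooted_tree {X : Type*} [MetricSpace X] (κ : X → ℝ) (hκ : ∀ x, 0 < κ x)
    {lam : ℝ} (hlam : 1 < lam) (S : Finset X) (hsum : ∑ x ∈ S, lam / κ x < 1) (hS : S.Nonempty)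
    (θ : ℝ) (hθ : ∀ u ∈ S, ∀ v ∈ S, dist u v < 2 * θ) :
    ∃ (W : Type) (_ : Finite W) (T : WeightedTree W) (f : X → W) (r : W),
      (∀ u ∈ S, T.dist (f u) r = θ) ∧
      ∀ u ∈ S, ∀ v ∈ S, dist u v ≤ T.dist (f u) (f v) ∧
        T.dist (f u) (f v) ≤ 2 * κ u * dist u v := by
  classical
  induction S using Finset.strongInduction generalizing θ with
  | H S ih =>
  rcases S.eq_singleton_or_nontrivial hS.choose_spec with h1 | hS'
  · generalize hS.choose = a at h1
    subst h1
    have hθ0 : 0 < θ := by simpa using hθ a (by simp) a (by simp)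
    refine ⟨Unit ⊕ Unit, inferInstance, .join .single .single () () θ hθ0, fun _ => .inl (),
      .inr (), ?_, ?_⟩
    · simp [WeightedTree.join_dist_inl_inr, WeightedTree.dist_self]
    · intro u hu v hv
      rw [Finset.mem_singleton] at hu hv
      simp [hu, hv, WeightedTree.dist_self]
  obtain ⟨A, B, Δ, hΔ, hAB, hA, hB, hA0, hB0, ⟨u₀, hu₀, v₀, hv₀, hΔ₀⟩, hdiam, hcut⟩ :=
    exists_cut κ hκ hlam S hsum hS'
  have hΔθ : Δ / 2 < θ := by linarith [hθ u₀ hu₀ v₀ hv₀]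
  have hΔlam : Δ / 2 < lam * Δ / 2 := by nlinarith
  -- `θ₁` is the height of the node at which the two subtrees meet; its strict inequalities leave
  -- positive lengths for the edges below and above that node
  obtain ⟨θ₁, hθ₁, hθ₁'⟩ := exists_between (lt_min hΔθ hΔlam)
  obtain ⟨hθ₁θ, hθ₁lam⟩ := lt_min_iff.1 hθ₁'
  obtain ⟨θ₀, hθ₀, hθ₀₁⟩ := exists_between hθ₁
  have hmono : ∀ C ⊆ S, ∑ x ∈ C, lam / κ x < 1 := fun C hC =>
    (Finset.sum_le_sum_of_subset_of_nonneg hC fun x _ _ => by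
      have := hκ x; positivity).trans_lt hsum
  obtain ⟨W₁, _, T₁, f₁, r₁, hr₁, hf₁⟩ := ih A hA (hmono A hA.subset) hA0 θ₀ fun u hu v hv => by
    linarith [hdiam u (hA.subset hu) v (hA.subset hv)]
  obtain ⟨W₂, _, T₂, f₂, r₂, hr₂, hf₂⟩ := ih B hB (hmono B hB.subset) hB0 θ₀ fun u hu v hv => by
    linarith [hdiam u (hB.subset hu) v (hB.subset hv)]
  have hc : 0 < θ₁ - θ₀ := by linarith
  let f : X → ((W₁ ⊕ Unit) ⊕ W₂) ⊕ Unit := fun x =>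
    if x ∈ A then .inl (.inl (.inl (f₁ x))) else .inl (.inr (f₂ x))
  have hf₁' : ∀ x ∈ A, f x = .inl (.inl (.inl (f₁ x))) := fun x hx => if_pos hx
  have hf₂' : ∀ x ∉ A, f x = .inl (.inr (f₂ x)) := fun x hx => if_neg hx
  have hB' : ∀ x ∈ S, x ∉ A → x ∈ B := fun x hx hxA => by
    rw [← hAB, Finset.mem_union] at hx
    exact hx.resolve_left hxA
  let T := ((T₁.join .single r₁ () (θ₁ - θ₀) hc).join T₂ (.inr ()) r₂ (θ₁ - θ₀) hc).join .single
    (.inl (.inr ())) () (θ - θ₁) (by linarith)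
  have hcross : ∀ u ∈ A, ∀ v ∈ B, v ∉ A → T.dist (f u) (f v) = 2 * θ₁ := by
    intro u hu v hv hvA
    simp only [T, hf₁' u hu, hf₂' v hvA, WeightedTree.join_dist_inl,
      WeightedTree.join_dist_inl_inr, WeightedTree.dist_self, hr₁ u hu,
      T₂.dist_comm r₂, hr₂ v hv]
    ring
  refine ⟨_, inferInstance, T, f, .inr (), ?_, ?_⟩
  · intro u hu
    by_cases huA : u ∈ A
    · simp only [T, hf₁' u huA, WeightedTree.join_dist_inl,
        WeightedTree.join_dist_inl_inr, WeightedTree.dist_self, hr₁ u huA]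
      ring
    · have huB := hB' u hu huA
      simp only [T, hf₂' u huA, WeightedTree.join_dist_inl_inr,
        WeightedTree.dist_comm _ (Sum.inr (f₂ u)) (Sum.inl (Sum.inr ())),
        WeightedTree.dist_self, T₂.dist_comm r₂, hr₂ u huB]
      ring
  · intro u hu v hv
    by_cases huA : u ∈ A <;> by_cases hvA : v ∈ A
    · simpa only [T, hf₁' u huA, hf₁' v hvA, WeightedTree.join_dist_inl] using hf₁ u huA v hvA
    · rw [hcross u huA v (hB' v hv hvA) hvA]
      constructor
      · linarith [hdiam u hu v hv]
      · linarith [(hcut u huA v (hB' v hv hvA)).1]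
    · rw [T.dist_comm, hcross v hvA u (hB' u hu huA) huA]
      constructor
      · linarith [hdiam u hu v hv]
      · have := (hcut v hvA u (hB' u hu huA)).2
        rw [dist_comm] at this
        linarith
    · simpa only [T, hf₂' u huA, hf₂' v hvA, WeightedTree.join_dist_inl,
        WeightedTree.join_dist_inr] using hf₂ u (hB' u hu huA) v (hB' v hv hvA)

/-- The first `n` reciprocals of a function in `Phi` have a sum strictly below `1`, because the
series goes on with positive terms. -/
theorem sum_inv_lt_one_of_mem_Phi {α : ℕ+ → ℝ} (hα : α ∈ Phi) (n : ℕ) :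
    ∑ j : Fin n, 1 / α (Nat.succPNat j) < 1 := by
  obtain ⟨hpos, -, hsum, hle⟩ := hα
  let e : Fin (n + 1) ↪ ℕ+ :=
    ⟨fun j => Nat.succPNat j, fun i j h => Fin.ext (Nat.succPNat_injective h)⟩
  have h := (hsum.sum_le_tsum (Finset.univ.map e) fun i _ => (one_div_pos.2 (hpos i)).le).trans hle
  rw [Finset.sum_map, Fin.sum_univ_castSucc] at h
  have hlast : 0 < 1 / α (e (Fin.last n)) := one_div_pos.2 (hpos _)
  have heq : ∑ j : Fin n, 1 / α (e j.castSucc) = ∑ j : Fin n, 1 / α (Nat.succPNat j) := rfl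
  linarith

theorem exists_tree_of_mem_Phi {α : ℕ+ → ℝ} (hα : α ∈ Phi) (X : Type*) [MetricSpace X] (n : ℕ)
    (x : Fin n ≃ X) : ∃ (W : Type) (_ : Finite W) (T : WeightedTree W) (f : X → W),
      NonContractive (fun u v : X => dist u v) T.dist f ∧
      HasPriorityDistortion (fun u v : X => dist u v) T.dist x f (fun k => 2 * α k) := by
  rcases isEmpty_or_nonempty X with hX | hX
  · exact ⟨Unit, inferInstance, .single, fun _ => (), fun u => hX.elim u,
      fun j => hX.elim (x j)⟩
  have : Fintype X := .ofEquiv _ x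
  set σ := ∑ j : Fin n, 1 / α (Nat.succPNat j) with hσ
  have hσ0 : 0 ≤ σ := Finset.sum_nonneg fun j _ => (one_div_pos.2 (hα.1 _)).le
  have hσ1 : σ < 1 := sum_inv_lt_one_of_mem_Phi hα n
  -- this factor is above `1` and has a product below `1` with `σ`
  have hlam : 1 < 2 / (1 + σ) := by
    rw [lt_div_iff₀ (by linarith)]
    linarith
  obtain ⟨D, hD⟩ := (Set.finite_range fun p : X × X => dist p.1 p.2).bddAbove
  obtain ⟨W, hW, T, f, r, -, hf⟩ := exists_rooted_tree (fun u => α (Nat.succPNat (x.symm u)))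
    (fun u => hα.1 _) hlam Finset.univ (by
      rw [← x.sum_comp]
      simp only [Equiv.symm_apply_apply, div_eq_mul_one_div (2 / (1 + σ))]
      rw [← Finset.mul_sum, ← hσ, div_mul_eq_mul_div, div_lt_one (by linarith)]
      linarith) Finset.univ_nonempty (D / 2 + 1) (fun u _ v _ => by
        have : dist u v ≤ D := hD ⟨(u, v), rfl⟩
        linarith)
  refine ⟨W, hW, T, f, fun u v => (hf u (Finset.mem_univ _) v (Finset.mem_univ _)).1, ?_⟩
  intro j i _
  simpa using (hf (x j) (Finset.mem_univ _) (x i) (Finset.mem_univ _)).2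

/-! ### Distances in cycles -/

section

open scoped Fin.CommRing

/-- A function that grows by at most one along each edge is `1`-Lipschitz. -/
theorem le_add_dist_of_adj {V : Type*} {G : SimpleGraph V} (g : V → ℕ)
    (hg : ∀ v w, G.Adj v w → g w ≤ g v + 1) {v w : V} (h : G.Reachable v w) :
    g w ≤ g v + G.dist v w := by
  obtain ⟨p, hp⟩ := h.exists_walk_length_eq_dist
  rw [← hp]
  clear hp
  induction p with
  | nil => simp
  | cons hadj p ih =>
    have := hg _ _ hadj
    have := ih p.reachable
    rw [SimpleGraph.Walk.length_cons]
    omega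

theorem cycleGraph_adj_add_one {N : ℕ} (i : Fin (N + 2)) :
    (SimpleGraph.cycleGraph (N + 2)).Adj i (i + 1) := by
  rw [SimpleGraph.cycleGraph_adj]
  simp

theorem cycleGraph_dist_cast_le {N : ℕ} (i k : ℕ) :
    (SimpleGraph.cycleGraph (N + 2)).dist (i : Fin (N + 2)) ((i + k : ℕ) : Fin (N + 2)) ≤ k := by
  induction k with
  | zero => simp
  | succ k ih =>
    have hconn : (SimpleGraph.cycleGraph (N + 2)).Connected := SimpleGraph.cycleGraph_connected
    have h := hconn.dist_triangle
      (u := (i : Fin (N + 2))) (v := ((i + k : ℕ) : Fin (N + 2)))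
      (w := ((i + (k + 1) : ℕ) : Fin (N + 2)))
    have h1 := SimpleGraph.dist_eq_one_iff_adj.2 (cycleGraph_adj_add_one ((i + k : ℕ) : Fin (N + 2)))
    rw [← add_assoc, Nat.cast_succ] at h ⊢
    omega

/-- The distance of two vertices of a cycle is at least the length of the shorter arc between them.
The vertices are residues of natural numbers, so that `j = i + (N + 2)` may stand for the vertex
`i` itself. -/
theorem min_le_cycleGraph_dist {N : ℕ} {i j : ℕ} (hij : i ≤ j) (hj : j - i ≤ N + 2) :
    min (j - i) (N + 2 - (j - i)) ≤
      (SimpleGraph.cycleGraph (N + 2)).dist (i : Fin (N + 2)) (j : Fin (N + 2)) := by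
  rcases hj.eq_or_lt with h | h
  · simp [h]
  have hstep : ∀ t : Fin (N + 2), (t + 1).val = t.val + 1 ∨ (t.val = N + 1 ∧ (t + 1).val = 0) := by
    intro t
    rw [Fin.val_add_one]
    split_ifs with h
    · subst h; simp
    · simp
  have := le_add_dist_of_adj (G := SimpleGraph.cycleGraph (N + 2))
    (fun v => min (v - (i : Fin (N + 2))).val (N + 2 - (v - (i : Fin (N + 2))).val))
    (fun v w hvw => by
      rw [SimpleGraph.cycleGraph_adj] at hvw
      rcases hvw with h | h
      · rw [sub_eq_iff_eq_add.1 h, add_sub_assoc, add_comm (1 : Fin (N + 2))]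
        rcases hstep (w - i) with h | h <;> omega
      · rw [sub_eq_iff_eq_add.1 h, add_sub_assoc, add_comm (1 : Fin (N + 2))]
        rcases hstep (v - i) with h | h <;> omega)
    (SimpleGraph.cycleGraph_connected (n := N + 1) (i : Fin (N + 2)) (j : Fin (N + 2)))
  rwa [← Nat.cast_sub hij, Fin.val_natCast, Nat.mod_eq_of_lt h, sub_self, Fin.val_zero,
    Nat.zero_min, zero_add] at this

/-! ### Stretched edges -/

/-- A spanning tree of a cycle misses an edge, and stretches it to the length of the remaining
path. -/
theorem exists_stretched_edge_of_le_cycleGraph {N : ℕ} {T : SimpleGraph (Fin (N + 3))}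
    (hT : T ≤ SimpleGraph.cycleGraph (N + 3)) (hT' : T.IsTree) :
    ∃ i, N + 2 ≤ T.dist i (i + 1) := by
  obtain ⟨i, hi⟩ : ∃ i, ¬ T.Adj i (i + 1) := by
    by_contra! hcon
    have hle : SimpleGraph.cycleGraph (N + 3) ≤ T := by
      intro u v huv
      rw [SimpleGraph.cycleGraph_adj] at huv
      rcases huv with h | h
      · rw [sub_eq_iff_eq_add'.1 h]
        exact (hcon v).symm
      · rw [sub_eq_iff_eq_add'.1 h]
        exact hcon u
    exact hT'.isAcyclic.anti hle _ SimpleGraph.cycleGraph.isCycle_cycle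
  refine ⟨i, ?_⟩
  -- numbering the vertices along the path from `i + 1` to `i` changes by one along each edge
  have hstep : ∀ v : Fin (N + 3), v ≠ i →
      (v + 1 - (i + 1)).val = (v - (i + 1)).val + 1 := by
    intro v hv
    rw [add_sub_right_comm, Fin.val_add_one_of_lt']
    rw [Nat.lt_iff_add_one_le]
    by_contra h
    apply hv
    have h1 := (v - (i + 1)).isLt
    have h2 : v - (i + 1) = Fin.last _ := Fin.ext (by simp; omega)
    have h3 : (Fin.last (N + 2)) + 1 = 0 := by simp
    rw [← h2] at h3
    have : v - i = 0 := by rw [← h3]; abel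
    exact sub_eq_zero.1 this
  have h := le_add_dist_of_adj (G := T) (fun v => (v - (i + 1)).val) (fun v w hvw => by
      have hc := hT hvw
      rw [SimpleGraph.cycleGraph_adj] at hc
      rcases hc with h | h
      · rw [sub_eq_iff_eq_add'.1 h] at hvw ⊢
        rw [hstep w (by rintro rfl; exact hi hvw.symm)]
        omega
      · rw [sub_eq_iff_eq_add'.1 h] at hvw ⊢
        rw [hstep v (by rintro rfl; exact hi hvw)])
    (hT'.connected (i + 1) i)
  rw [T.dist_comm]
  simpa using h

/-- Two points of a sequence with short steps in a tree are joined by a walk every vertex of which is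
close to a point of the sequence between them. -/
theorem WeightedTree.exists_walk_near {W : Type*} (T : WeightedTree W) (g : ℕ → W) {L : ℝ}
    (hL : 0 < L) (hg : ∀ k, T.dist (g k) (g (k + 1)) < L) {p q : ℕ} (hpq : p ≤ q) :
    ∃ w : T.graph.Walk (g p) (g q), ∀ t ∈ w.support, ∃ u, p ≤ u ∧ u ≤ q ∧
      T.dist (g u) t < L / 2 := by
  induction q, hpq using Nat.le_induction with
  | base =>
    refine ⟨.nil, fun t ht => ⟨p, le_rfl, le_rfl, ?_⟩⟩
    rw [SimpleGraph.Walk.mem_support_nil_iff] at ht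
    rw [ht, T.dist_self]
    linarith
  | succ q hpq ih =>
    obtain ⟨w, hw⟩ := ih
    obtain ⟨s, hs⟩ := T.exists_isPath (g q) (g (q + 1))
    refine ⟨w.append s, fun t ht => ?_⟩
    rcases (SimpleGraph.Walk.mem_support_append_iff _ _).1 ht with h | h
    · obtain ⟨u, hpu, huq, hu⟩ := hw t h
      exact ⟨u, hpu, by omega, hu⟩
    · have h1 := T.dist_add_dist_of_mem_support hs h
      have h2 := hg q
      rcases lt_or_ge (T.dist (g q) t) (L / 2) with h3 | h3
      · exact ⟨q, hpq, by omega, h3⟩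
      · refine ⟨q + 1, by omega, le_rfl, ?_⟩
        rw [T.dist_comm]
        linarith

/-- A non-contractive map of a cycle into a tree stretches some edge to a constant fraction of the
length of the cycle. Otherwise the images of the three arcs between equally spaced vertices would
all pass close to the median of the images of these vertices, at points of the cycle that cannot
all be close to each other. -/
theorem exists_stretched_edge_of_nonContractive {N : ℕ} {W : Type*} (T : WeightedTree W)
    (f : Fin (N + 3) → W)
    (hf : NonContractive (graphMetric (SimpleGraph.cycleGraph (N + 3))) T.dist f) :
    ∃ i, ((N : ℝ) + 2) / 8 ≤ T.dist (f i) (f (i + 1)) := by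
  by_contra! hcon
  set g : ℕ → W := fun k => f (k : Fin (N + 3)) with hgdef
  set L : ℝ := ((N : ℝ) + 2) / 8 with hLdef
  have hL : 0 < L := by positivity
  have hg : ∀ k, T.dist (g k) (g (k + 1)) < L := fun k => by
    simpa [hgdef] using hcon (k : Fin (N + 3))
  set b := (N + 3) / 3 with hb
  set c := 2 * (N + 3) / 3 with hc
  have hg0 : g (N + 3) = g 0 := by simp [hgdef]
  obtain ⟨p, hp⟩ := T.exists_walk_near g hL hg (Nat.zero_le b)
  obtain ⟨q, hq⟩ := T.exists_walk_near g hL hg (show b ≤ c by omega)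
  obtain ⟨s, hs⟩ := T.exists_walk_near g hL hg (show c ≤ N + 3 by omega)
  obtain ⟨t, ht₁, ht₂, ht₃⟩ := T.exists_median (g 0) (g b) (g c)
  obtain ⟨u, -, hub, hu⟩ := hp t (ht₁ p)
  obtain ⟨v, hbv, hvc, hv⟩ := hq t (ht₂ q)
  obtain ⟨w, hcw, hwn, hw⟩ := hs t (by
    have := ht₃ (s.copy rfl hg0)
    rwa [SimpleGraph.Walk.support_copy] at this)
  have key : ∀ y z, y ≤ z → z - y ≤ N + 3 → T.dist (g y) t < L / 2 → T.dist (g z) t < L / 2 →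
      8 * min (z - y) (N + 3 - (z - y)) < N + 2 := by
    intro y z hyz hzy hy hz
    have h1 := hf (y : Fin (N + 3)) (z : Fin (N + 3))
    have h2 := T.dist_triangle (g y) t (g z)
    rw [T.dist_comm t] at h2
    have h3 : ((min (z - y) (N + 3 - (z - y)) : ℕ) : ℝ) < L :=
      calc _ ≤ _ := Nat.cast_le.2 (min_le_cycleGraph_dist (N := N + 1) hyz hzy)
        _ ≤ T.dist (g y) (g z) := h1
        _ < L := by linarith
    rw [hLdef, lt_div_iff₀ (by norm_num)] at h3
    rw [mul_comm]
    exact_mod_cast h3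
  have h1 := key u v (by omega) (by omega) hu hv
  have h2 := key v w (by omega) (by omega) hv hw
  have h3 := key u w (by omega) (by omega) hu hw
  omega

/-- If the edge `a b` is stretched to at least `D`, the point `x j` within distance `ℓ` of both its
ends suffers a distortion of at least `D / (2 * ℓ)` with one of them, provided that they have higher
rank; otherwise an end of rank at most `j` itself suffers a distortion of `D`. -/
theorem not_priorityDistortionLT_of_stretched_edge {n : ℕ} {Y : Type*} {G : SimpleGraph (Fin n)}
    (hG : G.Connected) (dY : Y → Y → ℝ) (hsymm : ∀ u v, dY u v = dY v u)
    (htri : ∀ u v w, dY u w ≤ dY u v + dY v w) (x : Fin n ≃ Fin n) (f : Fin n → Y) (α : ℕ+ → ℝ)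
    (hpos : ∀ k, 0 < α k) (hα : Monotone α) {D : ℝ} {a b : Fin n} (hab : G.Adj a b)
    (hD : D ≤ dY (f a) (f b)) (j : Fin n) (ℓ : ℕ) (ha : G.dist (x j) a ≤ ℓ)
    (hb : G.dist (x j) b ≤ ℓ) (hℓ : 2 * ℓ * α (Nat.succPNat j) ≤ D) :
    ¬ PriorityDistortionLT (graphMetric G) dY x f α := by
  rintro ⟨β, hβ, h⟩
  have hℓ1 : (1 : ℝ) ≤ ℓ := by
    rw [Nat.one_le_cast, Nat.one_le_iff_ne_zero]
    rintro rfl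
    rw [Nat.le_zero, hG.dist_eq_zero_iff] at ha hb
    exact hab.ne (ha.symm.trans hb)
  have hαj := hpos (Nat.succPNat j)
  have far : ∀ c, j < x.symm c → G.dist (x j) c ≤ ℓ →
      dY (f (x j)) (f c) < ℓ * α (Nat.succPNat j) := by
    intro c hc hcℓ
    have h1 := h j _ hc
    rw [Equiv.apply_symm_apply] at h1
    have h2 : 0 < graphMetric G (x j) c := Nat.cast_pos.2 <| hG.pos_dist_of_ne <| by
      rintro rfl
      simp at hc
    have h3 : graphMetric G (x j) c ≤ ℓ := Nat.cast_le.2 hcℓ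
    nlinarith [hβ (Nat.succPNat j)]
  have near : ∀ c d, G.Adj c d → x.symm c < x.symm d → x.symm c ≤ j → dY (f c) (f d) < D := by
    intro c d hcd hlt hle
    have h1 := h _ _ hlt
    have h2 : graphMetric G c d = 1 := by
      simpa [graphMetric] using SimpleGraph.dist_eq_one_iff_adj.2 hcd
    rw [Equiv.apply_symm_apply, Equiv.apply_symm_apply, h2, mul_one] at h1
    have h3 : α (Nat.succPNat (x.symm c)) ≤ α (Nat.succPNat j) := hα (Nat.succPNat_le_succPNat.2 hle)
    nlinarith [hβ (Nat.succPNat (x.symm c))]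
  rcases lt_trichotomy (x.symm a) (x.symm b) with hlt | heq | hlt
  · rcases le_or_gt (x.symm a) j with hle | hgt
    · linarith [near a b hab hlt hle]
    · linarith [htri (f a) (f (x j)) (f b), hsymm (f a) (f (x j)), far a hgt ha,
        far b (hgt.trans hlt) hb]
  · exact hab.ne (x.symm.injective heq)
  · rcases le_or_gt (x.symm b) j with hle | hgt
    · linarith [near b a hab.symm hlt hle, hsymm (f a) (f b)]
    · linarith [htri (f a) (f (x j)) (f b), hsymm (f a) (f (x j)), far b hgt hb,
        far a (hgt.trans hlt) ha]

end

/-! ### A ranking that covers the cycle -/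

theorem exists_one_lt_sum_of_notMem_Phi {α : ℕ+ → ℝ} (hpos : ∀ k, 0 < α k) (hα : Monotone α)
    (hΦ : α ∉ Phi) : ∃ m, 1 < ∑ j ∈ Finset.range m, 1 / α (Nat.succPNat j) := by
  by_contra! hcon
  have hnn : ∀ j : ℕ, 0 ≤ 1 / α (Nat.succPNat j) := fun j => (one_div_pos.2 (hpos _)).le
  have h1 := summable_of_sum_range_le hnn hcon
  have h2 := Real.tsum_le_of_sum_range_le hnn hcon
  refine hΦ ⟨hpos, hα, Equiv.pnatEquivNat.symm.summable_iff.1 h1, ?_⟩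
  rwa [← Equiv.pnatEquivNat.symm.tsum_eq]

section

open scoped Fin.CommRing

/-- Consecutive arcs of radii `r 0, …, r (m - 1)` that exhaust the cycle have distinct centres,
which can therefore be given the ranks `0, …, m - 1`. -/
theorem exists_ranking_of_radii {N m : ℕ} (r : ℕ → ℕ) (hr : ∀ j < m, 1 ≤ r j) (hm : m ≤ N + 2)
    (hsum : N + 2 ≤ ∑ j ∈ Finset.range m, 2 * r j) :
    ∃ x : Fin (N + 2) ≃ Fin (N + 2), ∀ a, ∃ j : Fin (N + 2),
      (SimpleGraph.cycleGraph (N + 2)).dist (x j) a ≤ r j ∧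
      (SimpleGraph.cycleGraph (N + 2)).dist (x j) (a + 1) ≤ r j := by
  set P : ℕ → ℕ := fun j => ∑ i ∈ Finset.range j, 2 * r i with hP
  have hPsucc : ∀ j, P (j + 1) = P j + 2 * r j := fun j => Finset.sum_range_succ _ _
  have hPmono : Monotone P := monotone_nat_of_le_succ fun j => by rw [hPsucc]; omega
  -- the last arc may overlap the first one, so its centre is moved back into the range
  let c : ℕ → ℕ := fun j => min (P j + r j) (N + 1)
  have hcN : ∀ j, c j < N + 2 := fun j => by simp only [c]; omega
  let s : Set (Fin (N + 2)) := {j | P j < N + 2}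
  have hsm : ∀ j : ℕ, P j < N + 2 → j < m := fun j hj => by
    by_contra h
    have := hPmono (not_lt.1 h)
    simp only [hP] at this hj
    omega
  have hlt : ∀ i j : ℕ, i < j → P j < N + 2 → c i < c j := by
    intro i j hij hj
    have h1 := hPmono (Nat.succ_le_of_lt hij)
    have h2 := hr i (hij.trans (hsm j hj))
    have h3 := hr j (hsm j hj)
    rw [Nat.succ_eq_add_one, hPsucc] at h1
    simp only [c]
    omega
  have hinj : Set.InjOn (fun j : Fin (N + 2) => (⟨c j, hcN j⟩ : Fin (N + 2))) s := by
    intro i hi j hj hij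
    have hij' : c i = c j := congrArg Fin.val hij
    rcases lt_trichotomy i j with h | h | h
    · exact absurd hij' (hlt i j h hj).ne
    · exact h
    · exact absurd hij' (hlt j i h hi).ne'
  obtain ⟨e, he⟩ := Set.MapsTo.exists_equiv_extend_of_card_eq (t := Finset.univ)
    (by simp) (fun _ _ => by simp) hinj
  refine ⟨e.trans (Equiv.subtypeUnivEquiv (by simp)), fun a => ?_⟩
  have hex : ∃ k, (a : ℕ) < P (k + 1) := by
    refine ⟨m, ?_⟩
    have := hPmono (Nat.le_add_right m 1)
    simp only [hP] at this ⊢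
    omega
  have hj1 := Nat.find_spec hex
  have hj0 : P (Nat.find hex) ≤ a := by
    rcases h : Nat.find hex with _ | k
    · simp [hP]
    · exact not_lt.1 (Nat.find_min hex (m := k) (by omega))
  set j := Nat.find hex
  have hja : P j < N + 2 := by omega
  have hjm := hsm j hja
  refine ⟨⟨j, by omega⟩, ?_⟩
  have hxj : (e.trans (Equiv.subtypeUnivEquiv (by simp)) : Fin (N + 2) ≃ Fin (N + 2))
      ⟨j, by omega⟩ = ((c j : ℕ) : Fin (N + 2)) := by
    refine (he ⟨j, by omega⟩ hja).trans (Fin.ext ?_)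
    simp [Fin.val_natCast, Nat.mod_eq_of_lt (hcN j)]
  have hdist : ∀ k, c j ≤ k + r j → k ≤ c j + r j →
      (SimpleGraph.cycleGraph (N + 2)).dist ((c j : ℕ) : Fin (N + 2)) (k : Fin (N + 2)) ≤ r j := by
    intro k h1 h2
    rcases le_total (c j) k with h | h
    · have := cycleGraph_dist_cast_le (N := N) (c j) (k - c j)
      rw [Nat.add_sub_cancel' h] at this
      omega
    · have := cycleGraph_dist_cast_le (N := N) k (c j - k)
      rw [Nat.add_sub_cancel' h, SimpleGraph.dist_comm] at this
      omega
  have hr' := hr j hjm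
  have ha := a.isLt
  rw [hPsucc] at hj1
  rw [hxj]
  constructor
  · have := hdist a (by simp only [c]; omega) (by simp only [c]; omega)
    rwa [Fin.cast_val_eq_self] at this
  · have := hdist (a + 1) (by simp only [c]; omega) (by simp only [c]; omega)
    rwa [Nat.cast_succ, Fin.cast_val_eq_self] at this

/-- If the reciprocals of `α` have a partial sum above `1`, arcs around the points of smallest rank
cover a long cycle although the radius of the arc around the point of rank `j` is only about
`n / (2 * α j)`. -/
theorem exists_covering_ranking {α : ℕ+ → ℝ} (hpos : ∀ k, 0 < α k) (hα : Monotone α)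
    (hΦ : α ∉ Phi) : ∃ N : ℕ, ∃ x : Fin (N + 3) ≃ Fin (N + 3), ∀ a, ∃ (j : Fin (N + 3)) (ℓ : ℕ),
      (SimpleGraph.cycleGraph (N + 3)).dist (x j) a ≤ ℓ ∧
      (SimpleGraph.cycleGraph (N + 3)).dist (x j) (a + 1) ≤ ℓ ∧
      2 * ℓ * α (Nat.succPNat j) ≤ (N : ℝ) + 2 := by
  obtain ⟨m, hm⟩ := exists_one_lt_sum_of_notMem_Phi hpos hα hΦ
  set σ := ∑ j ∈ Finset.range m, 1 / α (Nat.succPNat j) with hσ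
  have hA : ∀ j, 0 < α (Nat.succPNat j) := fun j => hpos _
  -- the first two terms make room for `m` arcs of radius at least `1`; the last one makes up for
  -- rounding the radii down
  obtain ⟨N, hN⟩ := exists_nat_ge (m + ∑ j ∈ Finset.range m, 2 * α (Nat.succPNat j) +
    (2 * m + 1) / (σ - 1))
  have hS0 : 0 ≤ ∑ j ∈ Finset.range m, 2 * α (Nat.succPNat j) :=
    Finset.sum_nonneg fun j _ => by linarith [hA j]
  have hQ0 : 0 ≤ (2 * m + 1) / (σ - 1) := div_nonneg (by positivity) (by linarith)
  have hmN : m ≤ N := by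
    have : (m : ℝ) ≤ N := by linarith
    exact_mod_cast this
  have hlarge : 2 * (m : ℝ) + 1 ≤ N * (σ - 1) := by
    rw [← div_le_iff₀ (by linarith)]
    have : (0 : ℝ) ≤ m := by positivity
    linarith
  let r : ℕ → ℕ := fun j => ⌊((N : ℝ) + 2) / (2 * α (Nat.succPNat j))⌋₊
  have hr1 : ∀ j < m, 1 ≤ r j := by
    intro j hj
    refine Nat.le_floor ?_
    rw [Nat.cast_one, one_le_div (by linarith [hA j])]
    have h1 := Finset.single_le_sum (f := fun j => 2 * α (Nat.succPNat j))
      (fun j _ => by linarith [hA j]) (Finset.mem_range.2 hj)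
    have : (0 : ℝ) ≤ m := by positivity
    linarith
  have hr2 : N + 3 ≤ ∑ j ∈ Finset.range m, 2 * r j := by
    have h1 : ∑ j ∈ Finset.range m, (((N : ℝ) + 2) * (1 / α (Nat.succPNat j)) - 2) ≤
        ∑ j ∈ Finset.range m, 2 * (r j : ℝ) := by
      refine Finset.sum_le_sum fun j _ => ?_
      have h2 := Nat.lt_floor_add_one (((N : ℝ) + 2) / (2 * α (Nat.succPNat j)))
      have h3 : ((N : ℝ) + 2) * (1 / α (Nat.succPNat j)) =
          2 * (((N : ℝ) + 2) / (2 * α (Nat.succPNat j))) := by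
        have := (hA j).ne'
        field_simp
      rw [h3]
      simp only [r]
      linarith
    rw [Finset.sum_sub_distrib, ← Finset.mul_sum, ← hσ, Finset.sum_const, Finset.card_range,
      nsmul_eq_mul] at h1
    have h4 : (N : ℝ) + 3 ≤ ∑ j ∈ Finset.range m, 2 * (r j : ℝ) := by nlinarith
    exact_mod_cast h4
  obtain ⟨x, hx⟩ := exists_ranking_of_radii (N := N + 1) r hr1 (by omega) hr2
  refine ⟨N, x, fun a => ?_⟩
  obtain ⟨j, h1, h2⟩ := hx a
  refine ⟨j, r j, h1, h2, ?_⟩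
  have h3 : (r j : ℝ) ≤ ((N : ℝ) + 2) / (2 * α (Nat.succPNat j)) :=
    Nat.floor_le (div_nonneg (by positivity) (by linarith [hA j]))
  rw [le_div_iff₀ (by linarith [hA j])] at h3
  linarith

end

/-! ### Lower bounds -/

theorem nonneg_of_nonContractive {V Y : Type*} {G : SimpleGraph V} {dY : Y → Y → ℝ} {f : V → Y}
    (hf : NonContractive (graphMetric G) dY f) (u v : V) : 0 ≤ dY (f u) (f v) :=
  (Nat.cast_nonneg _).trans (hf u v)

/-- No priority distortion is less than a function with a non-positive first value. -/
theorem not_priorityDistortionLT_of_nonpos {n : ℕ} {Y : Type*} {G : SimpleGraph (Fin (n + 2))}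
    (hG : G.Connected) {dY : Y → Y → ℝ} {f : Fin (n + 2) → Y} (hd : ∀ u v, 0 ≤ dY (f u) (f v))
    (x : Fin (n + 2) ≃ Fin (n + 2)) {α : ℕ+ → ℝ} (h1 : α 1 ≤ 0) :
    ¬ PriorityDistortionLT (graphMetric G) dY x f α := by
  rintro ⟨β, hβ, h⟩
  have h2 := h 0 1 (by simp)
  have h3 : 0 < graphMetric G (x 0) (x 1) :=
    Nat.cast_pos.2 (hG.pos_dist_of_ne (x.injective.ne (by simp)))
  have h4 : β (Nat.succPNat ((0 : Fin (n + 2)) : ℕ)) < 0 := (hβ 1).trans_le h1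
  nlinarith [hd (x 0) (x 1)]

theorem graphMetric_symm {V : Type*} (G : SimpleGraph V) (u v : V) :
    graphMetric G u v = graphMetric G v u :=
  congrArg Nat.cast G.dist_comm

theorem graphMetric_triangle {V : Type*} {G : SimpleGraph V} (hG : G.Connected) (u v w : V) :
    graphMetric G u w ≤ graphMetric G u v + graphMetric G v w := by
  unfold graphMetric
  exact_mod_cast hG.dist_triangle

/-- The covering ranking defeats spanning trees and dominating trees alike: whichever edge of the
cycle is stretched, a point of small rank lies close to it. -/
theorem exists_ranking_of_notMem_Phi {α : ℕ+ → ℝ} (hα : Monotone α) (hΦ : α ∉ Phi) :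
    ∃ n : ℕ, 3 ≤ n ∧ ∃ x : Fin n ≃ Fin n,
      (¬ ∃ T : SimpleGraph (Fin n), T ≤ SimpleGraph.cycleGraph n ∧ T.IsTree ∧
        PriorityDistortionLT (graphMetric (SimpleGraph.cycleGraph n)) (graphMetric T) x id α) ∧
      (¬ ∃ (W : Type) (_ : Finite W) (T : WeightedTree W) (f : Fin n → W),
        NonContractive (graphMetric (SimpleGraph.cycleGraph n)) T.dist f ∧
        PriorityDistortionLT (graphMetric (SimpleGraph.cycleGraph n)) T.dist x f
          (fun k => α k / 8)) := by
  have hconn : ∀ N, (SimpleGraph.cycleGraph (N + 3)).Connected := fun N =>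
    SimpleGraph.cycleGraph_connected
  rcases le_or_gt (α 1) 0 with h1 | h1
  · refine ⟨3, le_rfl, Equiv.refl _, ?_, ?_⟩
    · rintro ⟨T, -, -, h⟩
      exact not_priorityDistortionLT_of_nonpos (hconn 0) (fun u v => Nat.cast_nonneg _) _ h1 h
    · rintro ⟨W, -, T, f, hf, h⟩
      exact not_priorityDistortionLT_of_nonpos (hconn 0) (nonneg_of_nonContractive hf) _
        (by linarith) h
  · have hpos : ∀ k, 0 < α k := fun k => h1.trans_le (hα one_le)
    obtain ⟨N, x, hx⟩ := exists_covering_ranking hpos hα hΦ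
    refine ⟨N + 3, by omega, x, ?_, ?_⟩
    · rintro ⟨T, hT, hT', h⟩
      obtain ⟨i, hi⟩ := exists_stretched_edge_of_le_cycleGraph hT hT'
      obtain ⟨j, ℓ, ha, hb, hℓ⟩ := hx i
      refine not_priorityDistortionLT_of_stretched_edge (hconn N) (graphMetric T)
        (graphMetric_symm T) (graphMetric_triangle hT'.connected) x id α hpos hα
        (cycleGraph_adj_add_one i) (D := (N : ℝ) + 2) ?_ j ℓ ha hb hℓ h
      simp only [graphMetric, id]
      exact_mod_cast hi
    · rintro ⟨W, -, T, f, hf, h⟩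
      obtain ⟨i, hi⟩ := exists_stretched_edge_of_nonContractive T f hf
      obtain ⟨j, ℓ, ha, hb, hℓ⟩ := hx i
      exact not_priorityDistortionLT_of_stretched_edge (hconn N) T.dist T.dist_comm
        T.dist_triangle x f _ (fun k => div_pos (hpos k) (by norm_num))
        (fun k l hkl => div_le_div_of_nonneg_right (hα hkl) (by norm_num))
        (cycleGraph_adj_add_one i) hi j ℓ ha hb (by linarith) h

theorem theorem3 :
    -- lower bounds on a cycle, for spanning trees and for arbitrary dominating trees
    (∀ α : ℕ+ → ℝ, Monotone α → α ∉ Phi →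
      ∃ n : ℕ, 3 ≤ n ∧ ∃ x : Fin n ≃ Fin n,
        (¬ ∃ T : SimpleGraph (Fin n), T ≤ SimpleGraph.cycleGraph n ∧ T.IsTree ∧
          PriorityDistortionLT (graphMetric (SimpleGraph.cycleGraph n)) (graphMetric T) x id α) ∧
        (¬ ∃ (W : Type) (_ : Finite W) (T : WeightedTree W) (f : Fin n → W),
          NonContractive (graphMetric (SimpleGraph.cycleGraph n)) T.dist f ∧
          PriorityDistortionLT (graphMetric (SimpleGraph.cycleGraph n)) T.dist x f
            (fun k => α k / 8))) ∧
    -- tightness up to constants: the matching upper bound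
    (∀ α : ℕ+ → ℝ, α ∈ Phi →
      ∀ (X : Type) [MetricSpace X] (n : ℕ) (x : Fin n ≃ X),
        ∃ (W : Type) (_ : Finite W) (T : WeightedTree W) (f : X → W),
          NonContractive (fun u v : X => dist u v) T.dist f ∧
          HasPriorityDistortion (fun u v : X => dist u v) T.dist x f (fun k => 2 * α k)) := by
  exact ⟨fun _ hα hΦ => exists_ranking_of_notMem_Phi hα hΦ,
    fun _ hα X _ n x => exists_tree_of_mem_Phi hα X n x⟩
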